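/- **Theorem 1.1.** Let $0\le k\le n$ be integers with $n\ge 1$, and put $R=k/n$. For a field $\mathbb F$ and distinct $\alpha_1,\dots,\alpha_n\in\mathbb F$, let $C_\alpha\subseteq\mathbb F^n$ be the $(n,k)$-Reed–Solomon code with evaluation points $\alpha$, that is, the row space of the $k\times n$ Vandermonde matrix with entries $\alpha_j^{\,i}$ ($0\le i<k$, $1\le j\le n$). A code $C\subseteq\mathbb F^n$ is *$(\rho,L)$-list decodable* if every Hamming ball of radius $\rho n$ in $\mathbb F^n$ contains at most $L$ codewords, and *$(\rho,L)$-average-radius list decodable* if there are no $L+1$ distinct codewords $c_0,\dots,c_L\in C$ and $y\in\mathbb F^n$ with $\frac1{L+1}\sum_{i=0}^{L}\operatorname{wt}(c_i-y)\le\rho n$, where $\operatorname{wt}$ is the Hamming weight. Then a generic $(n,k)$-Reed–Solomon code $C_\alpha$ has optimal list decodability. Precisely, there is a polynomial $P\in\mathbb Z[x_1,\dots,x_n]$, depending only on $n$ and $k$, whose image in $\mathbb F[x_1,\dots,x_n]$ is nonzero for every field $\mathbb F$, such that for every field $\mathbb F$ and every $\alpha\in\mathbb F^n$ with $P(\alpha)\neq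 0$ the $\alpha_i$ are distinct and: 1. for every integer $L\ge 1$, the code $C_\alpha$ is both $(\rho,L)$-list decodable and $(\rho,L)$-average-radius list decodable for $$\rho=1-R-\frac{1-R}{L+1};$$ 2. $C_\alpha$ achieves list-decoding capacity: for every real $\varepsilon>0$ and every integer $L\ge 1$ with $L\ge\frac{1-R-\varepsilon}{\varepsilon}$, it is $(1-R-\varepsilon,L)$-list decodable. -/

import Mathlib

universe u

noncomputable section

/-- The `k × n` Vandermonde matrix with rows `(α_1^i, …, α_n^i)`, `0 ≤ i < k`. -/
def rsGenerator {F : Type u} [Field F] {n : ℕ} (k : ℕ) (α : Fin n → F) :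
    Matrix (Fin k) (Fin n) F :=
  Matrix.of fun i j => α j ^ (i : ℕ)

/-- The Reed–Solomon code with evaluation points `α` (meant for pairwise distinct points):
the row space of the Vandermonde matrix. -/
def rsCode {F : Type u} [Field F] {n : ℕ} (k : ℕ) (α : Fin n → F) :
    Submodule F (Fin n → F) :=
  Submodule.span F (Set.range (rsGenerator k α).row)

open Classical in
/-- `(ρ, L)`-list decodability: every Hamming ball of radius `ρ n` contains at most `L`
codewords. -/
def IsListDecodable {F : Type u} [Field F] {n : ℕ} (C : Submodule F (Fin n → F))
    (ρ : ℝ) (L : ℕ) : Prop :=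
  ∀ y : Fin n → F,
    {c : Fin n → F | c ∈ C ∧ (hammingDist c y : ℝ) ≤ ρ * n}.encard ≤ (L : ℕ∞)

open Classical in
/-- `(ρ, L)`-average-radius list decodability: there are no `L + 1` distinct codewords whose
average Hamming distance to some word `y` is at most `ρ n`. -/
def IsAverageRadiusListDecodable {F : Type u} [Field F] {n : ℕ}
    (C : Submodule F (Fin n → F)) (ρ : ℝ) (L : ℕ) : Prop :=
  ¬ ∃ (c : Fin (L + 1) → (Fin n → F)) (y : Fin n → F),
    Function.Injective c ∧ (∀ i, c i ∈ C) ∧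
      (1 / ((L : ℝ) + 1)) * ∑ i, (hammingNorm (c i - y) : ℝ) ≤ ρ * n

/-- A property `Q` of points of `F^n`, for varying fields `F`, holds for generic points:
it holds off one fixed hypersurface, given by an integer polynomial that does not become the zero
polynomial over any field.  The polynomial is the same for all fields.  In particular `Q` then holds
for points whose coordinates are algebraically independent over the prime field (symbolic vectors),
and off a proper algebraic subset over every infinite field. -/
def HoldsForGenericPoint (n : ℕ) (Q : ∀ (F : Type u) [Field F], (Fin n → F) → Prop) : Prop :=
  ∃ P : MvPolynomial (Fin n) ℤ,
    (∀ (F : Type u) [Field F], MvPolynomial.map (Int.castRingHom F) P ≠ 0) ∧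
    ∀ (F : Type u) [Field F] (α : Fin n → F), MvPolynomial.aeval α P ≠ 0 → Q F α

end

/-! If `L + 1` codewords are too close on average to `y`, their agreement sets A_i with `y` satisfy
∑|A_i| ≥ n + Lk ≥ |⋃A_i| + Lk. Shrinking the family and the sets (`exists_isBalanced`) leaves at
least two sets for which |⋃A_i| − k = ∑(|A_i| − k), while every nonempty subfamily satisfies ≥. Let
V(A) be the space of rational functions with at most simple poles at the a_j, j ∈ A, and a zero of
order > k at infinity. Its dimension is |A| − k, so balance says that the V(A_i) have the dimensions
of a direct sum decomposition of V(⋃A_i). For generic points they do span it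
(`IsBalanced.generically_spansAt`). Pairing this with interpolation (`eq_of_spansAt`) makes the
message polynomials of the subfamily coincide, a contradiction.

Spanning is the nonvanishing of a determinant, so one good point suffices. The induction contracts a
tight proper subfamily, or moves a pole to the origin (hence the weights `w`), or lowers the highest
pole at the origin. The determinant has integer coefficients and is nonzero over every field. Only
finitely many systems of subsets of n points exist, whatever `L` is, so one product of determinants
serves them all. -/

open Polynomial

noncomputable section

/-! ### Generic properties -/

/-- A property of points of affine space that holds off a proper hypersurface. -/
def Generically {F ι : Type*} [Field F] (p : (ι → F) → Prop) : Prop :=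
  ∃ Q : MvPolynomial ι F, Q ≠ 0 ∧ ∀ a, MvPolynomial.eval a Q ≠ 0 → p a

theorem Generically.mono {F ι : Type*} [Field F] {p q : (ι → F) → Prop} (h : Generically p)
    (hpq : ∀ a, p a → q a) : Generically q := by
  obtain ⟨Q, hQ, H⟩ := h
  exact ⟨Q, hQ, fun a ha => hpq a (H a ha)⟩

theorem Generically.and {F ι : Type*} [Field F] {p q : (ι → F) → Prop} (hp : Generically p)
    (hq : Generically q) : Generically fun a => p a ∧ q a := by
  obtain ⟨Q, hQ, H⟩ := hp
  obtain ⟨Q', hQ', H'⟩ := hq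
  refine ⟨Q * Q', mul_ne_zero hQ hQ', fun a ha => ?_⟩
  rw [map_mul] at ha
  exact ⟨H a (left_ne_zero_of_mul ha), H' a (right_ne_zero_of_mul ha)⟩

theorem Generically.of_forall {F ι : Type*} [Field F] {p : (ι → F) → Prop} (h : ∀ a, p a) :
    Generically p :=
  ⟨1, one_ne_zero, fun a _ => h a⟩

theorem Generically.exists {F ι : Type*} [Field F] [Infinite F] {p : (ι → F) → Prop}
    (h : Generically p) : ∃ a, p a := by
  obtain ⟨Q, hQ, H⟩ := h
  by_contra! hp
  refine hQ (MvPolynomial.funext fun a => ?_)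
  rw [map_zero]
  by_contra h0
  exact hp a (H a h0)

theorem generically_forall_mem_ne_zero {F ι : Type*} [Field F] (s : Finset ι) :
    Generically fun a : ι → F => ∀ j ∈ s, a j ≠ 0 := by
  refine ⟨∏ j ∈ s, MvPolynomial.X j, ?_, fun a ha => ?_⟩
  · exact Finset.prod_ne_zero_iff.2 fun j _ => MvPolynomial.X_ne_zero j
  · rw [map_prod, Finset.prod_ne_zero_iff] at ha
    simpa using ha

/-! ### Set systems, their pole spaces and the spanning determinant -/

section Systems

variable {ι τ : Type*} [DecidableEq ι]

/-- The dimension of the space of rational functions with at most simple poles in `⋃ A i`, a pole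
of order at most `max w i` at `0`, and a zero of order more than `κ` at infinity. -/
def poleDim (κ : ℕ) (A : τ → Finset ι) (w : τ → ℕ) (I : Finset τ) : ℕ :=
  (I.sup A).card + I.sup w - κ

/-- The dimension condition under which the spaces of rational functions with prescribed poles
form a direct sum decomposition. -/
structure IsBalanced (κ : ℕ) (A : τ → Finset ι) (w : τ → ℕ) (T : Finset τ) : Prop where
  le : ∀ i ∈ T, κ ≤ (A i).card + w i
  sum_le : ∀ I ⊆ T, I.Nonempty → ∑ i ∈ I, poleDim κ A w {i} ≤ poleDim κ A w I
  sum_eq : ∑ i ∈ T, poleDim κ A w {i} = poleDim κ A w T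

/-- The cofactor that brings the `i`-th denominator to the common denominator. -/
def cofactor {R : Type*} [CommRing R] (A : τ → Finset ι) (w : τ → ℕ) (T : Finset τ) (a : ι → R)
    (i : τ) : R[X] :=
  X ^ (T.sup w - w i) * ∏ j ∈ T.sup A \ A i, (X - C (a j))

/-- The spaces of rational functions with poles prescribed by `A i` and `w i` together span the
space with poles prescribed by `⋃ A i` and `max w i`. -/
def SpansAt {F : Type*} [Field F] (κ : ℕ) (A : τ → Finset ι) (w : τ → ℕ) (T : Finset τ)
    (a : ι → F) : Prop :=
  ∀ q ∈ degreeLT F (poleDim κ A w T), ∃ r : τ → F[X],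
    (∀ i ∈ T, r i ∈ degreeLT F (poleDim κ A w {i})) ∧ q = ∑ i ∈ T, cofactor A w T a i * r i

theorem poleDim_singleton (κ : ℕ) (A : τ → Finset ι) (w : τ → ℕ) (i : τ) :
    poleDim κ A w {i} = (A i).card + w i - κ := by
  simp [poleDim]

theorem poleDim_mono (κ : ℕ) (A : τ → Finset ι) (w : τ → ℕ) {I J : Finset τ} (h : I ⊆ J) :
    poleDim κ A w I ≤ poleDim κ A w J := by
  have h1 := Finset.card_le_card (Finset.sup_mono (f := A) h)
  have h2 := Finset.sup_mono (f := w) h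
  unfold poleDim
  omega

theorem cofactor_map {R S : Type*} [CommRing R] [CommRing S] (φ : R →+* S) (A : τ → Finset ι)
    (w : τ → ℕ) (T : Finset τ) (a : ι → R) (i : τ) :
    (cofactor A w T a i).map φ = cofactor A w T (fun j => φ (a j)) i := by
  simp [cofactor, Polynomial.map_prod]

theorem cofactor_mul_mem {F : Type*} [Field F] {κ : ℕ} {A : τ → Finset ι} {w : τ → ℕ}
    {T : Finset τ} (hle : ∀ i ∈ T, κ ≤ (A i).card + w i) (a : ι → F) {i : τ} (hi : i ∈ T)
    {r : F[X]} (hr : r ∈ degreeLT F (poleDim κ A w {i})) :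
    cofactor A w T a i * r ∈ degreeLT F (poleDim κ A w T) := by
  by_cases h0 : r = 0
  · simp [h0]
  have hm : (cofactor A w T a i).Monic :=
    (monic_X_pow _).mul (monic_prod_of_monic _ _ fun j _ => monic_X_sub_C _)
  have hd : (cofactor A w T a i).natDegree = T.sup w - w i + (T.sup A \ A i).card := by
    unfold cofactor
    rw [Monic.natDegree_mul (monic_X_pow _) (monic_prod_of_monic _ _ fun j _ => monic_X_sub_C _),
      natDegree_X_pow, natDegree_prod_of_monic _ _ fun j _ => monic_X_sub_C _]
    simp
  rw [mem_degreeLT, ← natDegree_lt_iff_degree_lt h0, poleDim_singleton] at hr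
  rw [mem_degreeLT, ← natDegree_lt_iff_degree_lt (mul_ne_zero hm.ne_zero h0),
    natDegree_mul hm.ne_zero h0, hd]
  have h1 := Finset.card_sdiff_add_card_eq_card (Finset.le_sup (f := A) hi)
  have h2 := Finset.le_sup (f := w) hi
  have h3 := hle i hi
  unfold poleDim
  omega

/-- The matrix of the generators `cofactor i * X ^ e` in the monomial basis. -/
def spanMatrix {R : Type*} [CommRing R] (κ : ℕ) (A : τ → Finset ι) (w : τ → ℕ) (T : Finset τ)
    (a : ι → R) : Matrix (Σ i : T, Fin (poleDim κ A w {i.1})) (Fin (poleDim κ A w T)) R :=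
  Matrix.of fun p c => (cofactor A w T a p.1 * X ^ (p.2 : ℕ)).coeff c

theorem IsBalanced.nonempty_equiv {κ : ℕ} {A : τ → Finset ι} {w : τ → ℕ} {T : Finset τ}
    (h : IsBalanced κ A w T) :
    Nonempty (Fin (poleDim κ A w T) ≃ Σ i : T, Fin (poleDim κ A w {i.1})) := by
  refine ⟨Fintype.equivOfCardEq ?_⟩
  rw [Fintype.card_sigma]
  simp only [Fintype.card_fin]
  rw [Finset.sum_coe_sort T fun i => poleDim κ A w {i}, h.sum_eq]

/-- The determinant that decides whether the generators span. -/
def spanDet {R : Type*} [CommRing R] {κ : ℕ} {A : τ → Finset ι} {w : τ → ℕ} {T : Finset τ}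
    (e : Fin (poleDim κ A w T) ≃ Σ i : T, Fin (poleDim κ A w {i.1})) (a : ι → R) : R :=
  ((spanMatrix κ A w T a).submatrix e id).det

theorem map_spanDet {R S : Type*} [CommRing R] [CommRing S] (φ : R →+* S) {κ : ℕ}
    {A : τ → Finset ι} {w : τ → ℕ} {T : Finset τ}
    (e : Fin (poleDim κ A w T) ≃ Σ i : T, Fin (poleDim κ A w {i.1})) (a : ι → R) :
    φ (spanDet e a) = spanDet e fun j => φ (a j) := by
  unfold spanDet
  rw [RingHom.map_det]
  congr 1
  ext x c
  simp only [RingHom.mapMatrix_apply, Matrix.map_apply, Matrix.submatrix_apply, spanMatrix,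
    Matrix.of_apply, id]
  rw [← coeff_map, Polynomial.map_mul, cofactor_map, Polynomial.map_pow, map_X]

theorem coeff_sum_cofactor_mul {F : Type*} [Field F] {κ : ℕ} {A : τ → Finset ι} {w : τ → ℕ}
    {T : Finset τ} (e : Fin (poleDim κ A w T) ≃ Σ i : T, Fin (poleDim κ A w {i.1}))
    (a : ι → F) (r : τ → F[X]) (hr : ∀ i ∈ T, r i ∈ degreeLT F (poleDim κ A w {i}))
    (c : Fin (poleDim κ A w T)) :
    (∑ i ∈ T, cofactor A w T a i * r i).coeff c =
      Matrix.vecMul (fun x => (r (e x).1).coeff ((e x).2 : ℕ))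
        ((spanMatrix κ A w T a).submatrix e id) c := by
  simp only [Matrix.vecMul, dotProduct, Matrix.submatrix_apply, id]
  rw [e.sum_comp fun p => (r p.1).coeff (p.2 : ℕ) * spanMatrix κ A w T a p c,
    Fintype.sum_sigma, finsetSum_coeff, ← Finset.sum_coe_sort]
  refine Finset.sum_congr rfl fun i _ => ?_
  have h : r i = ∑ d : Fin (poleDim κ A w {i.1}), C ((r i).coeff d) * X ^ (d : ℕ) := by
    rw [Fin.sum_univ_eq_sum_range fun d => C ((r i).coeff d) * X ^ d]
    have := hr i i.2
    by_cases h0 : r i = 0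
    · simp [h0]
    rw [mem_degreeLT, ← natDegree_lt_iff_degree_lt h0] at this
    exact as_sum_range_C_mul_X_pow' _ this
  conv_lhs => rw [h]
  rw [Finset.mul_sum, finsetSum_coeff]
  refine Finset.sum_congr rfl fun d _ => ?_
  rw [mul_left_comm, coeff_C_mul]
  rfl

/-- The bijection `e` makes the generator matrix square, so spanning is surjectivity of a square
matrix. -/
theorem spansAt_iff_spanDet_ne_zero {F : Type*} [Field F] {κ : ℕ} {A : τ → Finset ι}
    {w : τ → ℕ} {T : Finset τ} (hle : ∀ i ∈ T, κ ≤ (A i).card + w i)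
    (e : Fin (poleDim κ A w T) ≃ Σ i : T, Fin (poleDim κ A w {i.1})) (a : ι → F) :
    SpansAt κ A w T a ↔ spanDet e a ≠ 0 := by
  classical
  rw [spanDet, ← isUnit_iff_ne_zero, ← Matrix.isUnit_iff_isUnit_det,
    ← Matrix.vecMul_surjective_iff_isUnit]
  constructor
  · intro h y
    obtain ⟨r, hr, hq⟩ := h (∑ c : Fin (poleDim κ A w T), C (y c) * X ^ (c : ℕ)) (by
      refine Submodule.sum_mem _ fun c _ => ?_
      rw [mem_degreeLT]
      exact (degree_C_mul_X_pow_le _ _).trans_lt (by exact_mod_cast c.2))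
    refine ⟨_, funext fun c => (coeff_sum_cofactor_mul e a r hr c).symm.trans ?_⟩
    rw [← hq, finsetSum_coeff]
    simp [coeff_C_mul, coeff_X_pow, Fin.val_inj]
  · intro h q hq
    obtain ⟨v, hv⟩ := h fun c => q.coeff c
    let r : τ → F[X] := fun i => if hi : i ∈ T then
      ∑ d : Fin (poleDim κ A w {i}), C (v (e.symm ⟨⟨i, hi⟩, d⟩)) * X ^ (d : ℕ) else 0
    have hr : ∀ i ∈ T, r i ∈ degreeLT F (poleDim κ A w {i}) := by
      intro i hi
      simp only [r, dif_pos hi]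
      refine Submodule.sum_mem _ fun c _ => ?_
      rw [mem_degreeLT]
      exact (degree_C_mul_X_pow_le _ _).trans_lt (by exact_mod_cast c.2)
    have hv' : (fun x => (r (e x).1).coeff ((e x).2 : ℕ)) = v := by
      funext x
      simp only [r, dif_pos (e x).1.2, finsetSum_coeff, coeff_C_mul, coeff_X_pow, Fin.val_inj]
      simp
    refine ⟨r, hr, ?_⟩
    have hs : ∑ i ∈ T, cofactor A w T a i * r i ∈ degreeLT F (poleDim κ A w T) :=
      Submodule.sum_mem _ fun i hi => cofactor_mul_mem hle a hi (hr i hi)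
    ext c
    rw [mem_degreeLT, degree_lt_iff_coeff_zero] at hs hq
    by_cases hc : c < poleDim κ A w T
    · have := coeff_sum_cofactor_mul e a r hr ⟨c, hc⟩
      rw [hv'] at this
      exact (this.trans (congrFun hv ⟨c, hc⟩)).symm
    · rw [hs c (not_lt.1 hc), hq c (not_lt.1 hc)]

/-- The determinant is a polynomial in the points, and one nonzero value shows that it is not the
zero polynomial. -/
theorem IsBalanced.generically_of_spansAt {F : Type*} [Field F] {κ : ℕ} {A : τ → Finset ι}
    {w : τ → ℕ} {T : Finset τ} (h : IsBalanced κ A w T) {a : ι → F} (ha : SpansAt κ A w T a) :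
    Generically fun a : ι → F => SpansAt κ A w T a := by
  obtain ⟨e⟩ := h.nonempty_equiv
  have key (b : ι → F) :
      MvPolynomial.eval b (spanDet e fun j => (MvPolynomial.X j : MvPolynomial ι F)) =
        spanDet e b := by
    rw [map_spanDet]
    simp
  refine ⟨spanDet e fun j => MvPolynomial.X j, fun h0 => ?_, fun b hb => ?_⟩
  · apply (spansAt_iff_spanDet_ne_zero h.le e a).1 ha
    rw [← key, h0, map_zero]
  · rw [key] at hb
    exact (spansAt_iff_spanDet_ne_zero h.le e b).2 hb

/-- Common denominators are nested: passing from `i` to `b` and from `b` to `T` is passing from `i`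
to `T`. The primed system is the contracted one, with `j` standing for `b`. -/
theorem cofactor_mul_cofactor {R : Type*} [CommRing R] {A A' : τ → Finset ι} {w w' : τ → ℕ}
    {T T' b : Finset τ} (a : ι → R) {i j : τ} (hi : i ∈ b) (hb : b ⊆ T)
    (hA : T'.sup A' = T.sup A) (hw : T'.sup w' = T.sup w) (hAj : A' j = b.sup A)
    (hwj : w' j = b.sup w) :
    cofactor A' w' T' a j * cofactor A w b a i = cofactor A w T a i := by
  unfold cofactor
  rw [hA, hw, hAj, hwj]
  have h1 : T.sup A \ A i = (T.sup A \ b.sup A) ∪ (b.sup A \ A i) :=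
    (Finset.sdiff_union_sdiff_cancel (Finset.sup_mono hb) (Finset.le_sup (f := A) hi)).symm
  have h2 : T.sup w - w i = (T.sup w - b.sup w) + (b.sup w - w i) := by
    have := Finset.sup_mono (f := w) hb
    have := Finset.le_sup (f := w) hi
    omega
  rw [h1, h2, Finset.prod_union, pow_add]
  · ring
  · exact Finset.disjoint_left.2 fun x hx hx' =>
      (Finset.mem_sdiff.1 hx).2 (Finset.mem_sdiff.1 hx').1

theorem IsBalanced.subset {κ : ℕ} {A : τ → Finset ι} {w : τ → ℕ} {T b : Finset τ}
    (h : IsBalanced κ A w T) (hb : b ⊆ T)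
    (hsum : ∑ i ∈ b, poleDim κ A w {i} = poleDim κ A w b) : IsBalanced κ A w b :=
  ⟨fun i hi => h.le i (hb hi), fun I hI hn => h.sum_le I (hI.trans hb) hn, hsum⟩

/-! ### Moving a pole to the origin -/

theorem sup_erase (A : τ → Finset ι) (j : ι) (I : Finset τ) :
    (I.sup fun x => (A x).erase j) = (I.sup A).erase j := by
  ext x
  simp only [Finset.mem_sup, Finset.mem_erase]
  tauto

theorem poleDim_merge_singleton (κ : ℕ) (A : τ → Finset ι) (w : τ → ℕ) (j : ι) (x : τ) :
    poleDim κ (fun x => (A x).erase j) (fun x => w x + if j ∈ A x then 1 else 0) {x}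
      = poleDim κ A w {x} := by
  rw [poleDim_singleton, poleDim_singleton]
  by_cases hj : j ∈ A x
  · have := Finset.card_erase_add_one hj
    simp only [hj, if_true]
    omega
  · simp [hj]

theorem sup_merge {A : τ → Finset ι} {w : τ → ℕ} {T : Finset τ} {i : τ} (hi : i ∈ T)
    (hw : w i = T.sup w) {j : ι} (hj : j ∈ A i) :
    (T.sup fun x => w x + if j ∈ A x then 1 else 0) = T.sup w + 1 := by
  apply le_antisymm
  · refine Finset.sup_le fun x hx => ?_
    have := Finset.le_sup (f := w) hx
    split_ifs <;> omega
  · have := Finset.le_sup (f := fun x => w x + if j ∈ A x then 1 else 0) hi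
    simp only [hj, if_true] at this
    omega

theorem poleDim_merge {κ : ℕ} {A : τ → Finset ι} {w : τ → ℕ} {T : Finset τ} {i : τ} (hi : i ∈ T)
    (hw : w i = T.sup w) {j : ι} (hj : j ∈ A i) :
    poleDim κ (fun x => (A x).erase j) (fun x => w x + if j ∈ A x then 1 else 0) T
      = poleDim κ A w T := by
  unfold poleDim
  rw [sup_merge hi hw hj, sup_erase,
    ← Finset.card_erase_add_one (Finset.le_sup (f := A) hi hj)]
  omega

/-- The dimensions of the members and of the whole family do not change. A proper subfamily may lose
one dimension, when its union loses `j` but its maximal weight does not rise; strictness pays for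
this. -/
theorem IsBalanced.merge {κ : ℕ} {A : τ → Finset ι} {w : τ → ℕ} {T : Finset τ}
    (h : IsBalanced κ A w T)
    (hstrict : ∀ I ⊂ T, 2 ≤ I.card → ∑ i ∈ I, poleDim κ A w {i} < poleDim κ A w I)
    {i : τ} (hi : i ∈ T) (hw : w i = T.sup w) {j : ι} (hj : j ∈ A i) :
    IsBalanced κ (fun x => (A x).erase j) (fun x => w x + if j ∈ A x then 1 else 0) T := by
  have hT := poleDim_merge (κ := κ) hi hw hj
  refine ⟨fun x hx => ?_, fun I hI hn => ?_, ?_⟩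
  · have := h.le x hx
    by_cases hjx : j ∈ A x
    · have := Finset.card_erase_add_one hjx
      simp only [hjx, if_true]
      omega
    · simpa [hjx] using this
  · rcases hI.eq_or_ssubset with rfl | hI'
    · rw [hT, ← h.sum_eq]
      exact (Finset.sum_congr rfl fun x _ => poleDim_merge_singleton κ A w j x).le
    rcases Nat.lt_or_ge I.card 2 with hc | hc
    · obtain ⟨x, rfl⟩ := Finset.card_eq_one.1 (le_antisymm (by omega) hn.card_pos)
      simp
    rw [Finset.sum_congr rfl fun x _ => poleDim_merge_singleton κ A w j x]
    have h1 := hstrict I hI' hc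
    refine Nat.le_of_lt_succ (h1.trans_le ?_)
    unfold poleDim
    rw [sup_erase]
    have h2 := Finset.pred_card_le_card_erase (s := I.sup A) (a := j)
    have h3 : I.sup w ≤ I.sup fun x => w x + if j ∈ A x then 1 else 0 :=
      Finset.sup_mono_fun fun x _ => Nat.le_add_right _ _
    omega
  · rw [hT, ← h.sum_eq]
    exact Finset.sum_congr rfl fun x _ => poleDim_merge_singleton κ A w j x

/-- At a_j = 0 the factor X − a_j becomes X, so the cofactors of the merged system are those of the
original one at the special point. Since denominators are cleared, this collision of poles does no
harm. -/
theorem spansAt_update_of_merge {F : Type*} [Field F] {κ : ℕ} {A : τ → Finset ι} {w : τ → ℕ}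
    {T : Finset τ} {i : τ} (hi : i ∈ T) (hw : w i = T.sup w) {j : ι} (hj : j ∈ A i) {a : ι → F}
    (h : SpansAt κ (fun x => (A x).erase j) (fun x => w x + if j ∈ A x then 1 else 0) T a) :
    SpansAt κ A w T (Function.update a j 0) := by
  intro q hq
  obtain ⟨r, hr, hqr⟩ := h q (by rwa [poleDim_merge hi hw hj])
  refine ⟨r, fun x hx => ?_, hqr.trans (Finset.sum_congr rfl fun x hx => ?_)⟩
  · rw [← poleDim_merge_singleton κ A w j]
    exact hr x hx
  congr 1
  unfold cofactor
  rw [sup_merge hi hw hj, sup_erase]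
  have hjT : j ∈ T.sup A := Finset.le_sup (f := A) hi hj
  have hxT := Finset.le_sup (f := w) hx
  have hprod : ∀ s : Finset ι, j ∉ s →
      ∏ l ∈ s, (X - C (Function.update a j 0 l)) = ∏ l ∈ s, (X - C (a l)) := by
    intro s hs
    refine Finset.prod_congr rfl fun l hl => ?_
    rw [Function.update_of_ne (ne_of_mem_of_not_mem hl hs)]
  by_cases hjx : j ∈ A x
  · have hs : (T.sup A).erase j \ (A x).erase j = T.sup A \ A x := by
      ext l
      simp only [Finset.mem_sdiff, Finset.mem_erase]
      by_cases hl : l = j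
      · subst hl
        simp [hjx]
      · simp [hl]
    rw [hs, hprod _ fun hm => (Finset.mem_sdiff.1 hm).2 hjx]
    simp only [hjx, if_true]
    congr 2
    omega
  · have hs : T.sup A \ A x = insert j ((T.sup A).erase j \ (A x).erase j) := by
      ext l
      simp only [Finset.mem_sdiff, Finset.mem_erase, Finset.mem_insert]
      by_cases hl : l = j
      · subst hl
        simp [hjx, hjT]
      · simp [hl]
    have hjn : j ∉ (T.sup A).erase j \ (A x).erase j := by simp
    rw [hs, Finset.prod_insert hjn, hprod _ hjn, Function.update_self]
    simp only [hjx, if_false]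
    have : T.sup w + 1 - (w x + 0) = (T.sup w - w x) + 1 := by omega
    rw [this, pow_succ]
    simp [mul_assoc]

/-! ### Contracting a tight subfamily -/

variable [DecidableEq τ]

/-- Gluing: a subsystem that spans can be replaced by a single member. -/
theorem spansAt_of_contract {F : Type*} [Field F] {κ : ℕ} {A : τ → Finset ι} {w : τ → ℕ}
    {T b : Finset τ} (hb : b ⊆ T) {i₁ : τ} (hi₁ : i₁ ∈ b) {a : ι → F}
    (h1 : SpansAt κ A w b a)
    (h2 : SpansAt κ (Function.update A i₁ (b.sup A)) (Function.update w i₁ (b.sup w))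
      (insert i₁ (T \ b)) a)
    (hA : (insert i₁ (T \ b)).sup (Function.update A i₁ (b.sup A)) = T.sup A)
    (hw : (insert i₁ (T \ b)).sup (Function.update w i₁ (b.sup w)) = T.sup w) :
    SpansAt κ A w T a := by
  have hi₁' : i₁ ∉ T \ b := fun h => (Finset.mem_sdiff.1 h).2 hi₁
  have hne {i : τ} (hi : i ∈ T \ b) : i ≠ i₁ := fun h => hi₁' (h ▸ hi)
  intro q hq
  have hdim : poleDim κ (Function.update A i₁ (b.sup A)) (Function.update w i₁ (b.sup w))
      (insert i₁ (T \ b)) = poleDim κ A w T := by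
    unfold poleDim
    rw [hA, hw]
  obtain ⟨r, hr, hqr⟩ := h2 q (by rwa [hdim])
  obtain ⟨s, hs, hrs⟩ := h1 (r i₁) (by
    have := hr i₁ (Finset.mem_insert_self _ _)
    rw [poleDim_singleton, Function.update_self, Function.update_self] at this
    exact this)
  refine ⟨fun i => if i ∈ b then s i else r i, fun i hi => ?_, ?_⟩
  · by_cases hib : i ∈ b
    · simpa [hib] using hs i hib
    · have hm := Finset.mem_sdiff.2 ⟨hi, hib⟩
      have := hr i (Finset.mem_insert_of_mem hm)
      rw [poleDim_singleton, Function.update_of_ne (hne hm), Function.update_of_ne (hne hm)]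
        at this
      simpa [hib, poleDim_singleton] using this
  · have e1 : ∑ i ∈ T \ b, cofactor A w T a i * (if i ∈ b then s i else r i) =
        ∑ i ∈ T \ b, cofactor (Function.update A i₁ (b.sup A)) (Function.update w i₁ (b.sup w))
          (insert i₁ (T \ b)) a i * r i := by
      refine Finset.sum_congr rfl fun i hi => ?_
      rw [if_neg (Finset.mem_sdiff.1 hi).2]
      unfold cofactor
      rw [hA, hw, Function.update_of_ne (hne hi), Function.update_of_ne (hne hi)]
    have e2 : ∑ i ∈ b, cofactor A w T a i * (if i ∈ b then s i else r i) =
        cofactor (Function.update A i₁ (b.sup A)) (Function.update w i₁ (b.sup w))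
          (insert i₁ (T \ b)) a i₁ * r i₁ := by
      rw [hrs, Finset.mul_sum]
      refine Finset.sum_congr rfl fun i hi => ?_
      rw [if_pos hi, ← mul_assoc, cofactor_mul_cofactor a hi hb hA hw (Function.update_self ..)
        (Function.update_self ..)]
    rw [hqr, Finset.sum_insert hi₁', ← Finset.sum_sdiff hb, e1, e2, add_comm]

theorem sup_insert_update {α : Type*} [SemilatticeSup α] [OrderBot α] (A : τ → α)
    {T b I : Finset τ} {i₁ : τ} (hI : I ⊆ T \ b) (hi₁ : i₁ ∈ b) :
    (insert i₁ I).sup (Function.update A i₁ (b.sup A)) = (b ∪ I).sup A := by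
  rw [Finset.sup_insert, Function.update_self, Finset.sup_union]
  congr 1
  refine Finset.sup_congr rfl fun i hi => Function.update_of_ne ?_ _ _
  rintro rfl
  exact (Finset.mem_sdiff.1 (hI hi)).2 hi₁

/-- A subfamily containing `i₁` corresponds to a subfamily of `T` containing all of `b`. Tightness
of `b` makes both the dimensions and their sums agree. -/
theorem IsBalanced.contract {κ : ℕ} {A : τ → Finset ι} {w : τ → ℕ} {T b : Finset τ}
    (h : IsBalanced κ A w T) (hb : b ⊆ T) {i₁ : τ} (hi₁ : i₁ ∈ b)
    (hsum : ∑ i ∈ b, poleDim κ A w {i} = poleDim κ A w b) :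
    IsBalanced κ (Function.update A i₁ (b.sup A)) (Function.update w i₁ (b.sup w))
      (insert i₁ (T \ b)) := by
  have hdim1 : poleDim κ (Function.update A i₁ (b.sup A)) (Function.update w i₁ (b.sup w)) {i₁}
      = poleDim κ A w b := by
    simp [poleDim]
  have hdim2 {i : τ} (hi : i ≠ i₁) :
      poleDim κ (Function.update A i₁ (b.sup A)) (Function.update w i₁ (b.sup w)) {i}
      = poleDim κ A w {i} := by
    simp [poleDim, Function.update_of_ne hi]
  have hdim3 {I : Finset τ} (hI : I ⊆ T \ b) :
      poleDim κ (Function.update A i₁ (b.sup A)) (Function.update w i₁ (b.sup w)) (insert i₁ I)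
      = poleDim κ A w (b ∪ I) := by
    unfold poleDim
    rw [sup_insert_update A hI hi₁, sup_insert_update w hI hi₁]
  have hnot {I : Finset τ} (hI : I ⊆ T \ b) : i₁ ∉ I := fun hm =>
    (Finset.mem_sdiff.1 (hI hm)).2 hi₁
  have hdisj {I : Finset τ} (hI : I ⊆ T \ b) : Disjoint b I :=
    (Finset.disjoint_sdiff (s := b) (t := T)).mono_right hI
  have hsum' {I : Finset τ} (hI : I ⊆ T \ b) :
      ∑ i ∈ I, poleDim κ (Function.update A i₁ (b.sup A)) (Function.update w i₁ (b.sup w)) {i}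
      = ∑ i ∈ I, poleDim κ A w {i} :=
    Finset.sum_congr rfl fun i hi => hdim2 fun he => hnot hI (he ▸ hi)
  have hsum'' {I : Finset τ} (hI : I ⊆ T \ b) : ∑ i ∈ insert i₁ I,
      poleDim κ (Function.update A i₁ (b.sup A)) (Function.update w i₁ (b.sup w)) {i}
      = ∑ i ∈ b ∪ I, poleDim κ A w {i} := by
    rw [Finset.sum_insert (hnot hI), hdim1, hsum' hI, Finset.sum_union (hdisj hI), hsum]
  refine ⟨fun i hi => ?_, fun I hI hn => ?_, ?_⟩
  · rcases eq_or_ne i i₁ with rfl | hne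
    · rw [Function.update_self, Function.update_self]
      have h1 := h.le i (hb hi₁)
      have h2 := Finset.card_le_card (Finset.le_sup (f := A) hi₁)
      have h3 := Finset.le_sup (f := w) hi₁
      omega
    · rw [Function.update_of_ne hne, Function.update_of_ne hne]
      exact h.le i (Finset.mem_sdiff.1 ((Finset.mem_insert.1 hi).resolve_left hne)).1
  · by_cases hm : i₁ ∈ I
    · have hI' : I.erase i₁ ⊆ T \ b := by
        intro x hx
        exact (Finset.mem_insert.1 (hI (Finset.mem_of_mem_erase hx))).resolve_left
          (Finset.ne_of_mem_erase hx)
      rw [← Finset.insert_erase hm, hsum'' hI', hdim3 hI']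
      exact h.sum_le _ (Finset.union_subset hb (hI'.trans Finset.sdiff_subset))
        ⟨i₁, Finset.mem_union_left _ hi₁⟩
    · have hI' : I ⊆ T \ b := fun x hx =>
        (Finset.mem_insert.1 (hI hx)).resolve_left fun he => hm (he ▸ hx)
      rw [hsum' hI']
      refine (h.sum_le I (hI'.trans Finset.sdiff_subset) hn).trans (le_of_eq ?_)
      unfold poleDim
      congr 2
      · congr 1
        exact Finset.sup_congr rfl fun i hi =>
          (Function.update_of_ne (ne_of_mem_of_not_mem hi hm) _ _).symm
      · exact Finset.sup_congr rfl fun i hi =>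
          (Function.update_of_ne (ne_of_mem_of_not_mem hi hm) _ _).symm
  · rw [hsum'' subset_rfl, hdim3 subset_rfl, Finset.union_sdiff_of_subset hb, h.sum_eq]

/-! ### Lowering the highest pole at the origin -/

theorem sup_update_of_mem {w : τ → ℕ} {T I : Finset τ} {i₀ : τ} (hw : w i₀ = T.sup w)
    (huniq : ∀ x ∈ T, w x = T.sup w → x = i₀) (hI : I ⊆ T) (hi₀ : i₀ ∈ I) :
    I.sup (Function.update w i₀ (T.sup w - 1)) = T.sup w - 1 := by
  apply le_antisymm
  · refine Finset.sup_le fun x hx => ?_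
    rcases eq_or_ne x i₀ with rfl | hne
    · rw [Function.update_self]
    · rw [Function.update_of_ne hne]
      have h1 := Finset.le_sup (f := w) (hI hx)
      have h2 : w x ≠ T.sup w := fun h => hne (huniq x (hI hx) h)
      omega
  · have := Finset.le_sup (f := Function.update w i₀ (T.sup w - 1)) hi₀
    rwa [Function.update_self] at this

/-- As `i₀` alone attains the maximal weight, exactly the subfamilies containing it lose a pole
order. The bound `hκ` keeps the subtraction of `κ` from truncating. -/
theorem poleDim_lower {κ : ℕ} {A : τ → Finset ι} {w : τ → ℕ} {T I : Finset τ} {i₀ : τ}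
    (hw : w i₀ = T.sup w) (huniq : ∀ x ∈ T, w x = T.sup w → x = i₀) (hκ : κ < T.sup w)
    (hI : I ⊆ T) :
    poleDim κ A (Function.update w i₀ (T.sup w - 1)) I + (if i₀ ∈ I then 1 else 0)
      = poleDim κ A w I := by
  unfold poleDim
  by_cases hm : i₀ ∈ I
  · rw [sup_update_of_mem hw huniq hI hm]
    have : I.sup w = T.sup w := le_antisymm (Finset.sup_mono hI) (hw ▸ Finset.le_sup hm)
    simp only [hm, if_true]
    omega
  · have : I.sup (Function.update w i₀ (T.sup w - 1)) = I.sup w :=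
      Finset.sup_congr rfl fun x hx => Function.update_of_ne (ne_of_mem_of_not_mem hx hm) _ _
    rw [this]
    simp [hm]

theorem sum_poleDim_lower {κ : ℕ} {A : τ → Finset ι} {w : τ → ℕ} {T I : Finset τ} {i₀ : τ}
    (hw : w i₀ = T.sup w) (huniq : ∀ x ∈ T, w x = T.sup w → x = i₀) (hκ : κ < T.sup w)
    (hI : I ⊆ T) :
    ∑ i ∈ I, poleDim κ A (Function.update w i₀ (T.sup w - 1)) {i} + (if i₀ ∈ I then 1 else 0)
      = ∑ i ∈ I, poleDim κ A w {i} := by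
  rw [← Finset.sum_congr rfl fun i (hi : i ∈ I) =>
    poleDim_lower (A := A) hw huniq hκ (Finset.singleton_subset_iff.2 (hI hi)),
    Finset.sum_add_distrib]
  simp

theorem IsBalanced.lower {κ : ℕ} {A : τ → Finset ι} {w : τ → ℕ} {T : Finset τ} {i₀ : τ}
    (h : IsBalanced κ A w T) (hw : w i₀ = T.sup w)
    (huniq : ∀ x ∈ T, w x = T.sup w → x = i₀) (hκ : κ < T.sup w) :
    IsBalanced κ A (Function.update w i₀ (T.sup w - 1)) T := by
  refine ⟨fun x hx => ?_, fun I hI hn => ?_, ?_⟩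
  · rcases eq_or_ne x i₀ with rfl | hne
    · rw [Function.update_self]
      omega
    · rw [Function.update_of_ne hne]
      exact h.le x hx
  · have h1 := h.sum_le I hI hn
    rw [← sum_poleDim_lower hw huniq hκ hI, ← poleDim_lower hw huniq hκ hI] at h1
    omega
  · have h1 := h.sum_eq
    rw [← sum_poleDim_lower hw huniq hκ subset_rfl, ← poleDim_lower hw huniq hκ subset_rfl] at h1
    omega

/-- The lowered total space has codimension one, and the missing direction is the coefficient of the
highest pole at the origin. The member `i₀` reaches it: its cofactor has nonzero constant term
because the other poles are away from 0. -/
theorem spansAt_of_lower {F : Type*} [Field F] {κ : ℕ} {A : τ → Finset ι} {w : τ → ℕ}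
    {T : Finset τ} {i₀ : τ} (hi₀ : i₀ ∈ T) (hA : A i₀ = ∅) (hw : w i₀ = T.sup w)
    (huniq : ∀ x ∈ T, w x = T.sup w → x = i₀) (hκ : κ < T.sup w) {a : ι → F}
    (ha : ∀ j ∈ T.sup A, a j ≠ 0)
    (h : SpansAt κ A (Function.update w i₀ (T.sup w - 1)) T a) : SpansAt κ A w T a := by
  have hdim : poleDim κ A w T = poleDim κ A (Function.update w i₀ (T.sup w - 1)) T + 1 := by
    rw [← poleDim_lower hw huniq hκ subset_rfl, if_pos hi₀]
  have hdim0 : poleDim κ A w {i₀} =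
      poleDim κ A (Function.update w i₀ (T.sup w - 1)) {i₀} + 1 := by
    rw [← poleDim_lower hw huniq hκ (Finset.singleton_subset_iff.2 hi₀),
      if_pos (Finset.mem_singleton_self _)]
  have hcof : ∀ x ∈ T, X * cofactor A (Function.update w i₀ (T.sup w - 1)) T a x =
      cofactor A w T a x * if x = i₀ then X else 1 := by
    intro x hx
    unfold cofactor
    rw [sup_update_of_mem hw huniq subset_rfl hi₀]
    rcases eq_or_ne x i₀ with rfl | hne
    · rw [Function.update_self, hw]
      simp [mul_comm]
    · rw [Function.update_of_ne hne, if_neg hne, mul_one, ← mul_assoc, ← pow_succ']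
      have h1 := Finset.le_sup (f := w) hx
      have h2 : w x ≠ T.sup w := fun h => hne (huniq x hx h)
      congr 2
      omega
  intro q hq
  set E := cofactor A w T a i₀ with hE
  have hE0 : E.coeff 0 ≠ 0 := by
    rw [hE, cofactor, hw, hA, Nat.sub_self, pow_zero, one_mul, coeff_zero_eq_eval_zero,
      eval_prod, Finset.sdiff_empty, Finset.prod_ne_zero_iff]
    intro j hj
    simpa using ha j hj
  -- This multiple of `E` cancels the constant term of `q`; the remainder is divisible by X and lies
  -- in the lowered space after division.
  set c := q.coeff 0 / E.coeff 0 with hc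
  have hEmem : E * C c ∈ degreeLT F (poleDim κ A w T) := by
    have hle : κ ≤ (A i₀).card + w i₀ := by omega
    by_cases h0 : c = 0
    · simp [h0]
    rw [mem_degreeLT, degree_mul_C h0]
    have hm : E.Monic :=
      (monic_X_pow _).mul (monic_prod_of_monic _ _ fun j _ => monic_X_sub_C _)
    rw [← natDegree_lt_iff_degree_lt hm.ne_zero]
    have hd : E.natDegree = (T.sup A).card := by
      rw [hE, cofactor, hw, hA, Nat.sub_self, pow_zero, one_mul,
        natDegree_prod_of_monic _ _ fun j _ => monic_X_sub_C _]
      simp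
    rw [hd, poleDim]
    omega
  have hdvd : X ∣ q - E * C c := by
    rw [X_dvd_iff, coeff_sub, coeff_mul_C, hc]
    field_simp
    simp
  obtain ⟨p, hp⟩ := hdvd
  have hpmem : p ∈ degreeLT F (poleDim κ A (Function.update w i₀ (T.sup w - 1)) T) := by
    have h1 := Submodule.sub_mem _ hq hEmem
    rw [hp, hdim] at h1
    by_cases h0 : p = 0
    · simp [h0]
    rw [mem_degreeLT, ← natDegree_lt_iff_degree_lt (mul_ne_zero X_ne_zero h0),
      natDegree_X_mul h0] at h1
    rw [mem_degreeLT, ← natDegree_lt_iff_degree_lt h0]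
    omega
  obtain ⟨r, hr, hpr⟩ := h p hpmem
  refine ⟨fun x => (if x = i₀ then X else 1) * r x + if x = i₀ then C c else 0, fun x hx => ?_, ?_⟩
  · rcases eq_or_ne x i₀ with rfl | hne
    · simp only [if_true]
      rw [hdim0]
      refine Submodule.add_mem _ ?_ ?_
      · have h1 := hr x hx
        by_cases h0 : r x = 0
        · simp [h0]
        rw [mem_degreeLT, ← natDegree_lt_iff_degree_lt h0] at h1
        rw [mem_degreeLT, ← natDegree_lt_iff_degree_lt (mul_ne_zero X_ne_zero h0),
          natDegree_X_mul h0]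
        omega
      · rw [mem_degreeLT]
        exact degree_C_le.trans_lt (by exact_mod_cast Nat.succ_pos _)
    · have h1 := hr x hx
      rw [poleDim_singleton, Function.update_of_ne hne] at h1
      simpa [hne, poleDim_singleton] using h1
  · have hq' : q = X * p + E * C c := by rw [← hp]; ring
    have e1 : ∑ x ∈ T, cofactor A w T a x * ((if x = i₀ then X else 1) * r x) = X * p := by
      rw [hpr, Finset.mul_sum]
      refine Finset.sum_congr rfl fun x hx => ?_
      rw [← mul_assoc, ← mul_assoc, hcof x hx]
    have e2 : ∑ x ∈ T, cofactor A w T a x * (if x = i₀ then C c else 0) = E * C c := by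
      rw [Finset.sum_eq_single i₀ (fun x _ hne => by rw [if_neg hne, mul_zero])
        fun h => absurd hi₀ h, if_pos rfl]
    rw [hq', ← e1, ← e2, ← Finset.sum_add_distrib]
    exact Finset.sum_congr rfl fun x _ => (mul_add _ _ _).symm

/-! ### Generic spanning of balanced systems -/

theorem IsBalanced.generically_spansAt {F : Type*} [Field F] [Infinite F] {κ : ℕ}
    {A : τ → Finset ι} {w : τ → ℕ} {T : Finset τ} (h : IsBalanced κ A w T) (hT : T.Nonempty) :
    Generically fun a : ι → F => SpansAt κ A w T a := by
  -- The union counts twice because moving a pole to the origin removes one point from it but raises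
  -- the maximal weight by one.
  induction hm : T.card + 2 * (T.sup A).card + T.sup w using Nat.strong_induction_on
    generalizing A w T with
  | _ m ih =>
  subst hm
  rcases Nat.eq_zero_or_pos (poleDim κ A w T) with hN | hN
  · refine Generically.of_forall fun a q hq => ⟨fun _ => 0, fun i _ => Submodule.zero_mem _, ?_⟩
    rw [hN, mem_degreeLT] at hq
    have : q = 0 := by simpa using hq
    simp [this]
  by_cases hC : ∃ b ⊂ T, 2 ≤ b.card ∧ ∑ i ∈ b, poleDim κ A w {i} = poleDim κ A w b
  · obtain ⟨b, hb, hb2, hsum⟩ := hC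
    obtain ⟨i₁, hi₁⟩ : b.Nonempty := Finset.card_pos.1 (by omega)
    have hA : (insert i₁ (T \ b)).sup (Function.update A i₁ (b.sup A)) = T.sup A := by
      rw [sup_insert_update A subset_rfl hi₁, Finset.union_sdiff_of_subset hb.1]
    have hw : (insert i₁ (T \ b)).sup (Function.update w i₁ (b.sup w)) = T.sup w := by
      rw [sup_insert_update w subset_rfl hi₁, Finset.union_sdiff_of_subset hb.1]
    have hcard := Finset.card_lt_card hb
    have h1 := ih _ (by
      have h1 := Finset.card_le_card (Finset.sup_mono (f := A) hb.1)
      have h2 := Finset.sup_mono (f := w) hb.1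
      omega) (h.subset hb.1 hsum) ⟨i₁, hi₁⟩ rfl
    have h2 := ih _ (by
      rw [hA, hw]
      have h1 := Finset.card_insert_le i₁ (T \ b)
      have h2 := Finset.card_sdiff_add_card_eq_card hb.1
      omega) (h.contract hb.1 hi₁ hsum) (Finset.insert_nonempty _ _) rfl
    exact (h1.and h2).mono fun a ha => spansAt_of_contract hb.1 hi₁ ha.1 ha.2 hA hw
  have hstrict : ∀ I ⊂ T, 2 ≤ I.card → ∑ i ∈ I, poleDim κ A w {i} < poleDim κ A w I := by
    intro I hI hc
    refine lt_of_le_of_ne (h.sum_le I hI.1 (Finset.card_pos.1 (by omega))) fun he => ?_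
    exact hC ⟨I, hI, hc, he⟩
  by_cases hM : ∃ i ∈ T, w i = T.sup w ∧ (A i).Nonempty
  · obtain ⟨i, hi, hw, j, hj⟩ := hM
    have h1 := ih _ (by
      rw [sup_merge hi hw hj, sup_erase,
        ← Finset.card_erase_add_one (Finset.le_sup (f := A) hi hj)]
      omega) (h.merge hstrict hi hw hj) hT rfl
    obtain ⟨a, ha⟩ := h1.exists
    exact h.generically_of_spansAt (spansAt_update_of_merge hi hw hj ha)
  have hE : ∀ i ∈ T, w i = T.sup w → A i = ∅ := by
    intro i hi hw
    by_contra hne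
    exact hM ⟨i, hi, hw, Finset.nonempty_iff_ne_empty.2 hne⟩
  obtain ⟨i₀, hi₀, hw'⟩ := Finset.exists_mem_eq_sup T hT w
  have hw := hw'.symm
  have hA := hE i₀ hi₀ hw
  have hdim0 : poleDim κ A w {i₀} = T.sup w - κ := by
    rw [poleDim_singleton, hA, hw, Finset.card_empty, zero_add]
  -- With `κ = T.sup w` the space of `i₀` would be zero, and the other members would carry the whole
  -- dimension. Strictness excludes this for two or more others. A single other `x` would have
  -- maximal weight, hence an empty set, and the total dimension would be 0, as it is with no
  -- others; this contradicts `hN`.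
  have hκ : κ < T.sup w := by
    have hle := h.le i₀ hi₀
    rw [hA, hw, Finset.card_empty, zero_add] at hle
    refine lt_of_le_of_ne hle fun he => ?_
    rw [← he, Nat.sub_self] at hdim0
    have hs := Finset.add_sum_erase T (fun i => poleDim κ A w {i}) hi₀
    simp only [hdim0, zero_add] at hs
    rw [h.sum_eq] at hs
    have hss : T.erase i₀ ⊂ T := Finset.erase_ssubset hi₀
    rcases Nat.lt_or_ge (T.erase i₀).card 2 with hc | hc
    · rcases Nat.lt_or_ge (T.erase i₀).card 1 with hc' | hc'
      · rw [Finset.card_eq_zero.1 (by omega : (T.erase i₀).card = 0)] at hs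
        simp at hs
        omega
      · obtain ⟨x, hx⟩ := Finset.card_eq_one.1 (le_antisymm (by omega) hc')
        have hTx : T = {i₀, x} := by rw [← Finset.insert_erase hi₀, hx]
        have hxT : x ∈ T := by rw [hTx]; simp
        have hsup : T.sup A = A x := by rw [hTx]; simp [hA]
        rw [hx, Finset.sum_singleton, poleDim_singleton] at hs
        have hN' := hN
        unfold poleDim at hs hN'
        rw [hsup] at hs hN'
        have := hE x hxT (by omega)
        rw [this, Finset.card_empty, zero_add] at hN'
        omega
    · have h1 := hstrict _ hss hc
      have h2 := poleDim_mono κ A w hss.1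
      omega
  -- Two members of maximal weight would have empty sets, hence the same space of positive
  -- dimension, which `sum_le` forbids for a pair.
  have huniq : ∀ x ∈ T, w x = T.sup w → x = i₀ := by
    intro x hx hwx
    by_contra hne
    have h1 := h.sum_le {x, i₀} (by
      intro y hy
      rcases Finset.mem_insert.1 hy with rfl | hy
      · exact hx
      · rwa [Finset.mem_singleton.1 hy]) ⟨x, by simp⟩
    rw [Finset.sum_pair hne, hdim0, poleDim_singleton] at h1
    unfold poleDim at h1
    simp [hA, hE x hx hwx, hwx, hw] at h1
    omega
  have h1 := ih _ (by
    rw [sup_update_of_mem hw huniq subset_rfl hi₀]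
    omega) (h.lower hw huniq hκ) hT rfl
  exact (h1.and (generically_forall_mem_ne_zero (T.sup A))).mono fun a ha =>
    spansAt_of_lower hi₀ hA hw huniq hκ ha.2 ha.1

/-- One integer polynomial controls spanning over all fields. -/
theorem IsBalanced.exists_int_polynomial {κ : ℕ} {A : τ → Finset ι} {w : τ → ℕ} {T : Finset τ}
    (h : IsBalanced κ A w T) (hT : T.Nonempty) :
    ∃ D : MvPolynomial ι ℤ,
      (∀ (F : Type*) [Field F], MvPolynomial.map (Int.castRingHom F) D ≠ 0) ∧
      ∀ (F : Type*) [Field F] (a : ι → F), MvPolynomial.aeval a D ≠ 0 → SpansAt κ A w T a := by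
  obtain ⟨e⟩ := h.nonempty_equiv
  have key (F : Type _) [Field F] (b : ι → F) :
      MvPolynomial.aeval b (spanDet e fun j => (MvPolynomial.X j : MvPolynomial ι ℤ)) =
        spanDet e b := by
    have := map_spanDet (MvPolynomial.aeval (R := ℤ) b).toRingHom e
      fun j => (MvPolynomial.X j : MvPolynomial ι ℤ)
    simpa using this
  refine ⟨spanDet e fun j => MvPolynomial.X j, fun F _ h0 => ?_, fun F _ b hb => ?_⟩
  -- `F` may be finite, so the good point is taken in its algebraic closure, which is infinite and
  -- has the same characteristic.
  · obtain ⟨a, ha⟩ := (h.generically_spansAt (F := AlgebraicClosure F) hT).exists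
    apply (spansAt_iff_spanDet_ne_zero h.le e a).1 ha
    have h1 := congrArg (MvPolynomial.aeval a) h0
    rw [map_spanDet] at h1
    simp only [MvPolynomial.map_X] at h1
    have h2 := map_spanDet (MvPolynomial.aeval (R := F) a).toRingHom e
      fun j => (MvPolynomial.X j : MvPolynomial ι F)
    simp at h1 h2
    rw [← h2]
    exact h1
  · rw [key] at hb
    exact (spansAt_iff_spanDet_ne_zero h.le e b).2 hb

end Systems

/-! ### Extracting a balanced subfamily -/

/-- A family of sets whose total size is large compared to its union contains a balanced
subfamily of smaller sets. -/
theorem exists_isBalanced {ι τ : Type*} [DecidableEq ι] (k : ℕ) (A : τ → Finset ι) (T : Finset τ)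
    (hT : 2 ≤ T.card) (h : (T.sup A).card + T.card * k ≤ ∑ i ∈ T, (A i).card + k) :
    ∃ H ⊆ T, ∃ A' : τ → Finset ι, (∀ i, A' i ⊆ A i) ∧ 2 ≤ H.card ∧
      IsBalanced k A' (fun _ => 0) H := by
  classical
  induction hm : T.card + ∑ i ∈ T, (A i).card using Nat.strong_induction_on
    generalizing A T with
  | _ m ih =>
  subst hm
  by_cases hI : ∃ I ⊂ T, 2 ≤ I.card ∧ (I.sup A).card + I.card * k ≤ ∑ i ∈ I, (A i).card + k
  · obtain ⟨I, hI, hc, hle⟩ := hI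
    obtain ⟨H, hH, A', hA', h2, hb⟩ := ih _ (add_lt_add_of_lt_of_le (Finset.card_lt_card hI)
      (Finset.sum_le_sum_of_subset hI.1)) A I hc hle rfl
    exact ⟨H, hH.trans hI.1, A', hA', h2, hb⟩
  have hsub : ∀ I ⊂ T, I.Nonempty →
      ∑ i ∈ I, (A i).card + k ≤ (I.sup A).card + I.card * k := by
    intro I hIT hn
    rcases Nat.lt_or_ge I.card 2 with hc | hc
    · obtain ⟨x, rfl⟩ := Finset.card_eq_one.1 (le_antisymm (by omega) hn.card_pos)
      simp
    · by_contra hlt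
      exact hI ⟨I, hIT, hc, by omega⟩
  have hTn : T.Nonempty := Finset.card_pos.1 (by omega)
  rcases h.lt_or_eq with hlt | heq
  -- With strict inequality the sets cannot be pairwise disjoint. Deleting a common point from one
  -- of two sets lowers the sum by one and does not enlarge the union, so the inequality survives.
  · have hk : k ≤ T.card * k := Nat.le_mul_of_pos_left k (by omega)
    have hnd : ¬ (T : Set τ).PairwiseDisjoint A := by
      intro hd
      have := Finset.card_biUnion hd
      rw [← Finset.sup_eq_biUnion] at this
      omega
    obtain ⟨i, hi, i', hi', hne, hd⟩ : ∃ i ∈ T, ∃ i' ∈ T, i ≠ i' ∧ ¬ Disjoint (A i) (A i') := by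
      simpa [Set.PairwiseDisjoint, Set.Pairwise] using hnd
    obtain ⟨x, hx, hx'⟩ := Finset.not_disjoint_iff.1 hd
    set B := Function.update A i ((A i).erase x) with hB
    have hBA : ∀ l, B l ⊆ A l := by
      intro l
      rcases eq_or_ne l i with rfl | hl
      · rw [hB, Function.update_self]
        exact Finset.erase_subset _ _
      · rw [hB, Function.update_of_ne hl]
    have hsum : ∑ l ∈ T, (B l).card + 1 = ∑ l ∈ T, (A l).card := by
      rw [← Finset.add_sum_erase T _ hi, ← Finset.add_sum_erase T (fun l => (A l).card) hi,
        hB, Function.update_self, ← Finset.card_erase_add_one hx,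
        Finset.sum_congr rfl fun l hl =>
          congrArg Finset.card (Function.update_of_ne (Finset.ne_of_mem_erase hl) _ A)]
      omega
    have hsup : (T.sup B).card ≤ (T.sup A).card :=
      Finset.card_le_card (Finset.sup_mono_fun fun l _ => hBA l)
    obtain ⟨H, hH, A', hA', h2, hb⟩ := ih _ (by omega) B T hT (by omega) rfl
    exact ⟨H, hH, A', fun l => (hA' l).trans (hBA l), h2, hb⟩
  have hall : ∀ I ⊆ T, I.Nonempty →
      ∑ i ∈ I, (A i).card + k ≤ (I.sup A).card + I.card * k := by
    intro I hIT hn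
    rcases hIT.eq_or_ssubset with rfl | hss
    · exact heq.ge
    · exact hsub I hss hn
  -- Equality for `T` is compared with the reverse inequality for `T.erase i`.
  have hk : ∀ i ∈ T, k ≤ (A i).card := by
    intro i hi
    have hc := Finset.card_erase_add_one hi
    have h1 := hall (T.erase i) (Finset.erase_subset _ _) (Finset.card_pos.1 (by omega))
    have h2 := Finset.card_le_card (Finset.sup_mono (f := A) (Finset.erase_subset i T))
    rw [← Finset.add_sum_erase T _ hi, ← hc] at heq
    rw [add_mul, one_mul] at heq
    omega
  have hsum : ∀ I ⊆ T, ∑ i ∈ I, poleDim k A (fun _ => 0) {i} + I.card * k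
      = ∑ i ∈ I, (A i).card := by
    intro I hIT
    rw [← smul_eq_mul, ← Finset.sum_const, ← Finset.sum_add_distrib]
    refine Finset.sum_congr rfl fun i hi => ?_
    have := hk i (hIT hi)
    rw [poleDim_singleton]
    omega
  have hdim : ∀ I ⊆ T, I.Nonempty → poleDim k A (fun _ => 0) I + k = (I.sup A).card := by
    rintro I hIT ⟨i, hi⟩
    have h1 := hk i (hIT hi)
    have h2 := Finset.card_le_card (Finset.le_sup (f := A) hi)
    have h3 : I.sup (fun _ => 0 : τ → ℕ) = 0 := Finset.sup_bot I
    unfold poleDim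
    omega
  refine ⟨T, subset_rfl, A, fun _ => subset_rfl, hT, fun i hi => hk i hi, fun I hIT hn => ?_, ?_⟩
  · have h1 := hsum I hIT
    have h2 := hdim I hIT hn
    have h3 := hall I hIT hn
    omega
  · have h1 := hsum T subset_rfl
    have h2 := hdim T subset_rfl hTn
    omega

/-! ### From spanning to list decoding -/

/-- Low degree polynomials that agree with one word on the members of a spanning system
coincide. -/
theorem eq_of_spansAt {F ι τ : Type*} [Field F] [DecidableEq ι] {k : ℕ} {A : τ → Finset ι}
    {T : Finset τ} {a : ι → F} (ha : Function.Injective a) (hle : ∀ i ∈ T, k ≤ (A i).card)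
    (hs : SpansAt k A (fun _ => 0) T a) {f : τ → F[X]} (hf : ∀ i ∈ T, f i ∈ degreeLT F k)
    {y : ι → F} (hy : ∀ i ∈ T, ∀ j ∈ A i, (f i).eval (a j) = y j) :
    ∃ h : F[X], ∀ i ∈ T, f i = h := by
  set J := T.sup A with hJ
  have hsub {i : τ} (hi : i ∈ T) : A i ⊆ J := Finset.le_sup (f := A) hi
  set h := Lagrange.interpolate J a y with hh
  have hev : ∀ j ∈ J, h.eval (a j) = y j := fun j hj =>
    Lagrange.eval_interpolate_at_node y ha.injOn hj
  have hdeg : h.degree < J.card := Lagrange.degree_interpolate_lt y ha.injOn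
  have hdim : poleDim k A (fun _ => 0) T = J.card - k := by
    have h3 : T.sup (fun _ => 0 : τ → ℕ) = 0 := Finset.sup_bot T
    rw [poleDim, h3, add_zero]
  have hk : h ∈ degreeLT F k := by
    by_cases h0 : h = 0
    · simp [h0]
    rw [mem_degreeLT, ← natDegree_lt_iff_degree_lt h0]
    rw [← natDegree_lt_iff_degree_lt h0] at hdeg
    by_contra hlt
    -- The exponent brings the product with `h` to degree exactly |J| − 1; it is an admissible
    -- numerator because deg h ≥ k.
    obtain ⟨r, hr, hq⟩ := hs (X ^ (J.card - 1 - h.natDegree)) (by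
      rw [mem_degreeLT, degree_X_pow, hdim]
      exact_mod_cast (by omega : J.card - 1 - h.natDegree < J.card - k))
    set s := ∑ i ∈ T, cofactor A (fun _ => 0) T a i * r i * f i with hsdef
    have hsdeg : s ∈ degreeLT F (J.card - 1) := by
      refine Submodule.sum_mem _ fun i hi => ?_
      have h1 := cofactor_mul_mem (w := fun _ => 0) hle a hi (hr i hi)
      have h2 := hf i hi
      by_cases h3 : cofactor A (fun _ => 0) T a i * r i * f i = 0
      · simp [h3]
      have h4 := left_ne_zero_of_mul h3
      have h5 := right_ne_zero_of_mul h3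
      rw [mem_degreeLT, ← natDegree_lt_iff_degree_lt h4, hdim] at h1
      rw [mem_degreeLT, ← natDegree_lt_iff_degree_lt h5] at h2
      rw [mem_degreeLT, ← natDegree_lt_iff_degree_lt h3, natDegree_mul h4 h5]
      omega
    have hqdeg : (X ^ (J.card - 1 - h.natDegree) * h).natDegree = J.card - 1 := by
      rw [natDegree_mul (pow_ne_zero _ X_ne_zero) h0, natDegree_X_pow]
      omega
    -- The two sides agree on `J`: at a point of `A i` both `h` and `f i` equal `y`, and elsewhere
    -- the cofactor of `i` vanishes. But `s` has degree less than |J| − 1.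
    have heq : X ^ (J.card - 1 - h.natDegree) * h = s := by
      refine eq_of_degree_sub_lt_of_eval_index_eq J ha.injOn ?_ fun j hj => ?_
      · refine (degree_sub_le _ _).trans_lt (max_lt ?_ ?_)
        · refine degree_le_natDegree.trans_lt ?_
          rw [hqdeg]
          exact_mod_cast (by omega : J.card - 1 < J.card)
        · refine (mem_degreeLT.1 hsdeg).trans_le ?_
          exact_mod_cast Nat.sub_le _ _
      · rw [hq, hsdef, Finset.sum_mul, eval_finsetSum, eval_finsetSum]
        refine Finset.sum_congr rfl fun i hi => ?_
        by_cases hj' : j ∈ A i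
        · simp only [eval_mul, hev j hj, hy i hi j hj']
        · have : (cofactor A (fun _ => 0) T a i).eval (a j) = 0 := by
            rw [cofactor, eval_mul, eval_prod, Finset.prod_eq_zero (Finset.mem_sdiff.2 ⟨hj, hj'⟩)
              (by simp), mul_zero]
          simp [this]
    rw [heq] at hqdeg
    by_cases hs0 : s = 0
    · rw [hs0] at heq
      exact mul_ne_zero (pow_ne_zero _ X_ne_zero) h0 heq
    · rw [mem_degreeLT, ← natDegree_lt_iff_degree_lt hs0] at hsdeg
      omega
  refine ⟨h, fun i hi => eq_of_degree_sub_lt_of_eval_index_eq (A i) ha.injOn ?_ fun j hj => ?_⟩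
  · refine (mem_degreeLT.1 (Submodule.sub_mem _ (hf i hi) hk)).trans_le ?_
    exact_mod_cast hle i hi
  · rw [hy i hi j hj, hev j (hsub hi hj)]

theorem exists_eval_eq_of_mem_rsCode {F : Type*} [Field F] {n k : ℕ} {α : Fin n → F}
    {c : Fin n → F} (hc : c ∈ rsCode k α) : ∃ f ∈ degreeLT F k, ∀ j, f.eval (α j) = c j := by
  have hle : rsCode k α ≤ (degreeLT F k).map (LinearMap.pi fun j => leval (α j)) := by
    refine Submodule.span_le.2 ?_
    rintro _ ⟨i, rfl⟩
    refine ⟨X ^ (i : ℕ), ?_, ?_⟩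
    · rw [SetLike.mem_coe, mem_degreeLT, degree_X_pow]
      exact_mod_cast i.2
    · ext j
      simp [rsGenerator, leval]
  obtain ⟨f, hf, rfl⟩ := hle hc
  exact ⟨f, hf, fun j => rfl⟩

theorem IsAverageRadiusListDecodable.isListDecodable {F : Type*} [Field F] {n : ℕ}
    {C : Submodule F (Fin n → F)} {ρ : ℝ} {L : ℕ} (h : IsAverageRadiusListDecodable C ρ L) :
    IsListDecodable C ρ L := by
  classical
  intro y
  by_contra hlt
  obtain ⟨t, ht, htc⟩ := Set.exists_subset_encard_eq (Order.add_one_le_of_lt (not_le.1 hlt))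
  have hfin : t.Finite := Set.finite_of_encard_eq_coe (k := L + 1) (by simpa using htc)
  have hcard : hfin.toFinset.card = L + 1 := by
    rw [hfin.encard_eq_coe_toFinset_card] at htc
    exact_mod_cast htc
  let e := hfin.toFinset.equivFinOfCardEq hcard
  have hmem (i : Fin (L + 1)) := ht (hfin.mem_toFinset.1 (e.symm i).2)
  refine h ⟨fun i => (e.symm i).1, y, Subtype.val_injective.comp e.symm.injective,
    fun i => (hmem i).1, ?_⟩
  have hsum : ∑ i, (hammingNorm ((e.symm i).1 - y) : ℝ) ≤ ∑ _i : Fin (L + 1), ρ * n := by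
    refine Finset.sum_le_sum fun i _ => ?_
    have := (hmem i).2
    rw [hammingDist_comm, hammingDist_eq_hammingNorm, neg_add_eq_sub] at this
    convert this
  rw [Finset.sum_const, Finset.card_univ, Fintype.card_fin, nsmul_eq_mul, Nat.cast_add_one] at hsum
  rw [div_mul_eq_mul_div, one_mul, div_le_iff₀ (by positivity)]
  refine le_trans (le_of_eq ?_) (hsum.trans_eq (mul_comm _ _))
  refine Finset.sum_congr rfl fun i _ => ?_
  congr!

theorem IsListDecodable.mono {F : Type*} [Field F] {n : ℕ} {C : Submodule F (Fin n → F)}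
    {ρ ρ' : ℝ} {L : ℕ} (h : IsListDecodable C ρ L) (hρ : ρ' ≤ ρ) : IsListDecodable C ρ' L :=
  fun y => (Set.encard_le_encard (Set.ofPred_subset_ofPred.2 fun _ hc =>
    ⟨hc.1, hc.2.trans (mul_le_mul_of_nonneg_right hρ (Nat.cast_nonneg n))⟩)).trans (h y)

/-- Indexing the system by its own sets leaves finitely many systems for given n, so the polynomial
need not depend on `L`. -/
theorem IsBalanced.image {ι τ : Type*} [DecidableEq ι] {k : ℕ} {A : τ → Finset ι} {H : Finset τ}
    (h : IsBalanced k A (fun _ => 0) H) (hinj : Set.InjOn A H) :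
    IsBalanced k (id : Finset ι → Finset ι) (fun _ => 0) (H.image A) := by
  classical
  have hdim (I : Finset τ) : poleDim k (id : Finset ι → Finset ι) (fun _ => 0) (I.image A) =
      poleDim k A (fun _ => 0) I := by
    unfold poleDim
    rw [Finset.sup_image, Finset.sup_image]
    rfl
  have hdim1 (i : τ) : poleDim k (id : Finset ι → Finset ι) (fun _ => 0) {A i} =
      poleDim k A (fun _ => 0) {i} := by
    rw [← hdim, Finset.image_singleton]
  refine ⟨fun S hS => ?_, fun I hI hn => ?_, ?_⟩
  · obtain ⟨i, hi, rfl⟩ := Finset.mem_image.1 hS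
    exact h.le i hi
  · obtain ⟨I', hI', rfl⟩ := Finset.subset_image_iff.1 hI
    rw [Finset.sum_image (hinj.mono hI'), hdim]
    simp only [hdim1]
    exact h.sum_le I' hI' (Finset.image_nonempty.1 hn)
  · rw [Finset.sum_image hinj, hdim]
    simp only [hdim1]
    exact h.sum_eq

/-- Reed–Solomon codes for which all balanced set systems span have no `L + 1` codewords that are
close on average to a single word. -/
theorem lt_sum_hammingNorm_of_spansAt {F : Type*} [Field F] [DecidableEq F] {n k L : ℕ}
    (hkn : k ≤ n) (hL : 1 ≤ L) {α : Fin n → F} (hα : Function.Injective α)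
    (hspan : ∀ T : Finset (Finset (Fin n)), T.Nonempty → IsBalanced k id (fun _ => 0) T →
      SpansAt k id (fun _ => 0) T α)
    {c : Fin (L + 1) → Fin n → F} (hinj : Function.Injective c) (hc : ∀ i, c i ∈ rsCode k α)
    (y : Fin n → F) : L * (n - k) < ∑ i, hammingNorm (c i - y) := by
  by_contra! hle
  choose f hf hfc using fun i => exists_eval_eq_of_mem_rsCode (hc i)
  let A : Fin (L + 1) → Finset (Fin n) := fun i => Finset.univ.filter fun j => c i j = y j
  have hA (i) : (A i).card + hammingNorm (c i - y) = n := by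
    have := Finset.card_filter_add_card_filter_not (s := (Finset.univ : Finset (Fin n)))
      fun j => c i j = y j
    rw [Finset.card_univ, Fintype.card_fin] at this
    refine Eq.trans ?_ this
    simp [A, hammingNorm, sub_eq_zero]
  have hsum : ∑ i, (A i).card + ∑ i, hammingNorm (c i - y) = (L + 1) * n := by
    rw [← Finset.sum_add_distrib, Finset.sum_congr rfl fun i _ => hA i]
    simp
  have hcard : (Finset.univ : Finset (Fin (L + 1))).card = L + 1 := by simp
  -- The agreement sets have total size at least (L + 1)n − L(n − k) = n + Lk.
  obtain ⟨H, -, A', hA', hH2, hbal⟩ := exists_isBalanced k A Finset.univ (by omega) (by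
    have h1 := Finset.card_le_univ ((Finset.univ : Finset (Fin (L + 1))).sup A)
    rw [Fintype.card_fin] at h1
    rw [hcard]
    obtain ⟨d, rfl⟩ := Nat.exists_eq_add_of_le hkn
    rw [Nat.add_sub_cancel_left] at hle
    nlinarith)
  have hy : ∀ i, ∀ j ∈ A' i, (f i).eval (α j) = y j := by
    intro i j hj
    rw [hfc]
    exact (Finset.mem_filter.1 (hA' i hj)).2
  have hfinj : Function.Injective f := by
    intro i i' h
    refine hinj (funext fun j => ?_)
    rw [← hfc, ← hfc, h]
  -- Equal sets have at least `k` points, so they already determine the polynomial of degree less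
  -- than `k`.
  have hAinj : Set.InjOn A' H := by
    intro i hi i' _ h
    refine hfinj (eq_of_degree_sub_lt_of_eval_index_eq (A' i) hα.injOn ?_ fun j hj => ?_)
    · refine (mem_degreeLT.1 (Submodule.sub_mem _ (hf i) (hf i'))).trans_le ?_
      exact_mod_cast hbal.le i hi
    · rw [hy i j hj, hy i' j (h ▸ hj)]
  obtain ⟨i, hi, i', hi', hne⟩ := Finset.one_lt_card.1 hH2
  have hbal' := hbal.image hAinj
  have hleft := hAinj.leftInvOn_invFunOn
  obtain ⟨h, hh⟩ := eq_of_spansAt (f := fun S => f (Function.invFunOn A' H S)) (y := y) hα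
    hbal'.le (hspan _ ⟨A' i, Finset.mem_image_of_mem _ hi⟩ hbal') (fun S _ => hf _) (by
      intro S hS j hj
      obtain ⟨l, hl, rfl⟩ := Finset.mem_image.1 hS
      simp only [hleft hl]
      exact hy l j hj)
  have h1 := hh _ (Finset.mem_image_of_mem A' hi)
  have h2 := hh _ (Finset.mem_image_of_mem A' hi')
  simp only [hleft hi, hleft hi'] at h1 h2
  exact hne (hfinj (h1.trans h2.symm))

theorem exists_polynomial_spansAt (n k : ℕ) : ∃ P : MvPolynomial (Fin n) ℤ,
    (∀ (F : Type u) [Field F], MvPolynomial.map (Int.castRingHom F) P ≠ 0) ∧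
    ∀ (F : Type u) [Field F] (α : Fin n → F), MvPolynomial.aeval α P ≠ 0 →
      Function.Injective α ∧ ∀ T : Finset (Finset (Fin n)), T.Nonempty →
        IsBalanced k id (fun _ => 0) T → SpansAt k id (fun _ => 0) T α := by
  have hD (T : Finset (Finset (Fin n))) : ∃ D : MvPolynomial (Fin n) ℤ,
      (∀ (F : Type u) [Field F], MvPolynomial.map (Int.castRingHom F) D ≠ 0) ∧
      ∀ (F : Type u) [Field F] (α : Fin n → F), MvPolynomial.aeval α D ≠ 0 → T.Nonempty →
        IsBalanced k id (fun _ => 0) T → SpansAt k id (fun _ => 0) T α := by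
    by_cases hT : T.Nonempty ∧ IsBalanced k id (fun _ => 0) T
    · obtain ⟨D, h1, h2⟩ := hT.2.exists_int_polynomial hT.1
      exact ⟨D, h1, fun F _ α hα _ _ => h2 F α hα⟩
    · exact ⟨1, fun F _ => by simp, fun F _ α _ h1 h2 => absurd ⟨h1, h2⟩ hT⟩
  choose D hD0 hD using hD
  -- The first product runs over all families of subsets of `Fin n`; the second forces distinct
  -- evaluation points.
  refine ⟨(∏ T, D T) * ∏ p ∈ Finset.univ.offDiag, (MvPolynomial.X p.1 - MvPolynomial.X p.2),
    fun F _ => ?_, fun F _ α hα => ?_⟩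
  · rw [map_mul, map_prod, map_prod]
    refine mul_ne_zero (Finset.prod_ne_zero_iff.2 fun T _ => hD0 T F)
      (Finset.prod_ne_zero_iff.2 fun p hp => ?_)
    rw [map_sub, MvPolynomial.map_X, MvPolynomial.map_X, sub_ne_zero]
    exact fun h => (Finset.mem_offDiag.1 hp).2.2 (MvPolynomial.X_injective h)
  · rw [map_mul, map_prod, map_prod] at hα
    have h1 := Finset.prod_ne_zero_iff.1 (left_ne_zero_of_mul hα)
    have h2 := Finset.prod_ne_zero_iff.1 (right_ne_zero_of_mul hα)
    refine ⟨fun i j hij => ?_, fun T hT hb => hD T F α (h1 T (Finset.mem_univ T)) hT hb⟩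
    by_contra hne
    apply h2 (i, j) (Finset.mem_offDiag.2 ⟨Finset.mem_univ _, Finset.mem_univ _, hne⟩)
    simp [hij]

end

theorem theorem1p1 (n k : ℕ) (hn : 0 < n) (hkn : k ≤ n) (R : ℝ) (hR : R = (k : ℝ) / (n : ℝ)) :
    HoldsForGenericPoint.{u} n (fun F [Field F] (α : Fin n → F) =>
      Function.Injective α ∧
      (∀ L : ℕ, 1 ≤ L →
        IsListDecodable (rsCode k α) (1 - R - (1 - R) / ((L : ℝ) + 1)) L ∧
        IsAverageRadiusListDecodable (rsCode k α) (1 - R - (1 - R) / ((L : ℝ) + 1)) L) ∧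
      (∀ ε : ℝ, 0 < ε → ∀ L : ℕ, 1 ≤ L → (1 - R - ε) / ε ≤ (L : ℝ) →
        IsListDecodable (rsCode k α) (1 - R - ε) L)) := by
  obtain ⟨P, hP0, hP⟩ := exists_polynomial_spansAt.{u} n k
  refine ⟨P, hP0, fun F _ α hα => ?_⟩
  obtain ⟨hinj, hspan⟩ := hP F α hα
  have havg : ∀ L : ℕ, 1 ≤ L →
      IsAverageRadiusListDecodable (rsCode k α) (1 - R - (1 - R) / ((L : ℝ) + 1)) L := by
    classical
    rintro L hL ⟨c, y, hc, hcC, hle⟩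
    have hlt := lt_sum_hammingNorm_of_spansAt hkn hL hinj hspan hc hcC y
    have hlt' : (L : ℝ) * (n - k) < ∑ i, (hammingNorm (c i - y) : ℝ) := by
      rw [← Nat.cast_sub hkn]
      exact_mod_cast hlt
    have hn' : (0 : ℝ) < n := Nat.cast_pos.2 hn
    have hρ : (1 - R - (1 - R) / ((L : ℝ) + 1)) * n = L * (n - k) / (L + 1) := by
      rw [hR]
      field_simp
      ring
    rw [hρ, div_mul_eq_mul_div, one_mul, div_le_div_iff_of_pos_right (by positivity)] at hle
    refine absurd (hlt'.trans_le (le_trans (le_of_eq ?_) hle)) (lt_irrefl _)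
    refine Finset.sum_congr rfl fun i _ => ?_
    congr!
  refine ⟨hinj, fun L hL => ⟨(havg L hL).isListDecodable, havg L hL⟩, fun ε hε L hL h => ?_⟩
  refine (havg L hL).isListDecodable.mono ?_
  have hL' : (0 : ℝ) < (L : ℝ) + 1 := by positivity
  rw [div_le_iff₀ hε] at h
  -- The bound on `L` says exactly 1 − R ≤ (L + 1)ε, so the capacity radius is at most the one
  -- already handled.
  have : (1 - R) / ((L : ℝ) + 1) ≤ ε := by
    rw [div_le_iff₀ hL']
    linarith
  linarith
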